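/- Let $d,r$ be positive integers with $r\ge 3$, and let $P$ be a cyclic polytope of dimension at least $2(d+1)$ with at least $(r-1)(d+1)+1$ vertices; that is, $P\subset\mathbb{R}^N$ is the convex hull of a finite set, and, with $m=\dim P$, the face lattice of $P$ is isomorphic to that of the convex hull of some $n\ge m+1$ distinct points on the moment curve $t\mapsto(t,t^2,\dots,t^m)$ in $\mathbb{R}^m$. Then for any linear function $f:P\to\mathbb{R}^d$ (that is, any map preserving convex combinations of points of $P$) there exist $r$ pairwise disjoint faces $F_1,\dots,F_r$ of $P$ whose images under $f$ intersect: $f(F_1)\cap\dots\cap f(F_r)\ne\emptyset$. -/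

import Mathlib

open Set

/-- A (convex) polytope: the convex hull of finitely many points. -/
def IsPolytope {N : ℕ} (P : Set (EuclideanSpace ℝ (Fin N))) : Prop :=
  ∃ V : Set (EuclideanSpace ℝ (Fin N)), V.Finite ∧ P = convexHull ℝ V

/-- The dimension of a polytope, i.e. the dimension of its affine span. -/
noncomputable def polytopeDim {N : ℕ} (P : Set (EuclideanSpace ℝ (Fin N))) : ℕ :=
  Module.finrank ℝ (vectorSpan ℝ P)

/-- The faces of a polytope `P`, ordered by inclusion: the empty set, and the sets of points of `P`
at which some linear functional attains its maximum over `P` (the zero functional gives `P`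
itself). -/
abbrev Face {N : ℕ} (P : Set (EuclideanSpace ℝ (Fin N))) : Type :=
  {F : Set (EuclideanSpace ℝ (Fin N)) // IsExposed ℝ P F}

/-- Two polytopes are combinatorially equivalent if their face lattices are isomorphic. -/
def CombinatoriallyEquivalent {N M : ℕ} (P : Set (EuclideanSpace ℝ (Fin N)))
    (Q : Set (EuclideanSpace ℝ (Fin M))) : Prop :=
  Nonempty (Face P ≃o Face Q)

/-- The moment curve `t ↦ (t, t², …, t^m)` in `ℝ^m`. -/
noncomputable def momentCurve (m : ℕ) (t : ℝ) : EuclideanSpace ℝ (Fin m) :=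
  WithLp.toLp 2 (fun i : Fin m => t ^ ((i : ℕ) + 1))

/-- The convex hull of the points of the moment curve with parameters `t 0, …, t (n - 1)`. -/
noncomputable def momentPolytope (m : ℕ) {n : ℕ} (t : Fin n → ℝ) :
    Set (EuclideanSpace ℝ (Fin m)) :=
  convexHull ℝ (range fun j => momentCurve m (t j))

/-- A polytope of dimension `m` is cyclic if it is combinatorially equivalent to the convex hull
of `n ≥ m + 1` distinct points on the moment curve in `ℝ^m`. -/
def IsCyclicPolytope {N : ℕ} (P : Set (EuclideanSpace ℝ (Fin N))) : Prop :=
  IsPolytope P ∧ ∃ (n : ℕ) (t : Fin n → ℝ), polytopeDim P + 1 ≤ n ∧ StrictMono t ∧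
    CombinatoriallyEquivalent P (momentPolytope (polytopeDim P) t)

/-- `f` is an affine ("linear") map on the convex set `P`: it preserves convex combinations of
points of `P`. Its values off `P` are irrelevant. -/
def IsAffineOn {N d : ℕ} (P : Set (EuclideanSpace ℝ (Fin N)))
    (f : EuclideanSpace ℝ (Fin N) → EuclideanSpace ℝ (Fin d)) : Prop :=
  ∀ x ∈ P, ∀ y ∈ P, ∀ a b : ℝ, 0 ≤ a → 0 ≤ b → a + b = 1 →
    f (a • x + b • y) = a • f x + b • f y

/-! Tverberg's theorem, applied to the images of the vertices of `P`, splits the vertices into `r`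
classes whose images have hulls sharing a point `p`. Carathéodory in `ℝᵈ` trims each class to at
most `d + 1` vertices, keeping `p` in the hull. A cyclic polytope of dimension at least `2(d + 1)`
is `(d + 1)`-neighborly, so each trimmed class is the vertex set of a face. These faces are
disjoint, because a common point would force a common vertex. Tverberg follows from colorful
Carathéodory by Sarkaria's tensor trick. Neighborliness is checked on the moment curve and carried
to `P` by the face lattice. -/

/-! ### Colorful Carathéodory, Tverberg and Carathéodory -/

open scoped RealInnerProductSpace in
/-- A point of least norm `z` of a convex set `K` satisfies `‖z‖² ≤ ⟪z, w⟫` for all `w ∈ K`. -/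
theorem norm_sq_le_inner_of_forall_norm_le {E : Type*} [NormedAddCommGroup E]
    [InnerProductSpace ℝ E] {K : Set E} (hK : Convex ℝ K) {z : E} (hz : z ∈ K)
    (hmin : ∀ w ∈ K, ‖z‖ ≤ ‖w‖) {w : E} (hw : w ∈ K) : ‖z‖ ^ 2 ≤ ⟪z, w⟫ := by
  have h := (norm_eq_iInf_iff_real_inner_le_zero (u := 0) hK hz).1 (by
    have : Nonempty K := ⟨⟨z, hz⟩⟩
    refine le_antisymm (le_ciInf fun w => by simpa using hmin w w.2) ?_
    exact ciInf_le (f := fun w : K => ‖(0 : E) - w‖) ⟨0, by rintro _ ⟨w, rfl⟩; positivity⟩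
      ⟨z, hz⟩) w hw
  rw [zero_sub, inner_neg_left, inner_sub_right, real_inner_self_eq_norm_sq] at h
  linarith

open scoped RealInnerProductSpace in
/-- If `z ≠ 0` is a convex combination of more than `finrank ℝ E` points `p i` on the far side of
the hyperplane through `z` orthogonal to `z`, then one of the points can be omitted. -/
theorem exists_mem_convexHull_image_ne {E : Type*} [NormedAddCommGroup E]
    [InnerProductSpace ℝ E] [FiniteDimensional ℝ E] {ι : Type*} [Fintype ι]
    (hcard : Module.finrank ℝ E + 1 ≤ Fintype.card ι) {p : ι → E} {z : E} (hz0 : z ≠ 0)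
    (hz : z ∈ convexHull ℝ (range p)) (hp : ∀ i, ‖z‖ ^ 2 ≤ ⟪z, p i⟫) :
    ∃ i₀, z ∈ convexHull ℝ (p '' {i | i ≠ i₀}) := by
  classical
  obtain ⟨τ, _, q, w, hq, hind, hw, hw1, hwz⟩ := eq_pos_convex_span_of_mem_convexHull hz
  choose g hg using fun s : τ => hq (mem_range_self s)
  -- The nonnegative excesses over `‖z‖ ^ 2` have positive weights and weighted sum zero, so each
  -- vanishes.
  have hinner : ∀ s, ⟪z, q s⟫ = ‖z‖ ^ 2 := by
    have hsum : ∑ s, w s * (⟪z, q s⟫ - ‖z‖ ^ 2) = 0 := by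
      have : ∑ s, w s * ⟪z, q s⟫ = ‖z‖ ^ 2 := by
        rw [← real_inner_self_eq_norm_sq]
        nth_rw 3 [← hwz]
        simp [inner_sum, inner_smul_right]
      simp only [mul_sub, Finset.sum_sub_distrib, this, ← Finset.sum_mul, hw1]
      ring
    have hnn : ∀ s ∈ Finset.univ, 0 ≤ w s * (⟪z, q s⟫ - ‖z‖ ^ 2) := fun s _ =>
      mul_nonneg (hw s).le (sub_nonneg.2 (hg s ▸ hp (g s)))
    intro s
    have h := (Finset.sum_eq_zero_iff_of_nonneg hnn).1 hsum s (Finset.mem_univ s)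
    rcases mul_eq_zero.1 h with h | h
    · exact absurd h (hw s).ne'
    · linarith
  have hτ : Fintype.card τ < Fintype.card ι := by
    have : Nonempty τ := by
      by_contra hne
      rw [not_nonempty_iff] at hne
      simp at hw1
    -- The `q s` lie in a hyperplane, which cannot hold `finrank + 1` affinely independent points.
    have hne : Fintype.card τ ≠ Module.finrank ℝ E + 1 := by
      intro h
      have htop := hind.vectorSpan_eq_top_of_card_eq_finrank_add_one h
      have hle : vectorSpan ℝ (range q) ≤ (ℝ ∙ z)ᗮ := by
        rw [vectorSpan_def, Submodule.span_le]
        rintro _ ⟨_, ⟨s, rfl⟩, _, ⟨s', rfl⟩, rfl⟩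
        simp [Submodule.mem_orthogonal_singleton_iff_inner_right, inner_sub_right, hinner]
      have hzm : z ∈ (ℝ ∙ z)ᗮ := hle (htop ▸ Submodule.mem_top)
      rw [Submodule.mem_orthogonal_singleton_iff_inner_right] at hzm
      exact hz0 (inner_self_eq_zero.1 hzm)
    have := hind.card_le_finrank_succ
    have := Submodule.finrank_le (vectorSpan ℝ (range q))
    omega
  obtain ⟨i₀, hi₀⟩ : ∃ i₀, i₀ ∉ Finset.univ.image g := by
    by_contra! h
    have := Finset.card_image_le (s := Finset.univ) (f := g)
    rw [Finset.eq_univ_iff_forall.2 h, Finset.card_univ, Finset.card_univ] at this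
    omega
  refine ⟨i₀, hwz ▸ (convex_convexHull ℝ _).sum_mem (fun s _ => (hw s).le) hw1 fun s _ =>
    subset_convexHull ℝ _ ⟨g s, ?_, hg s⟩⟩
  rintro rfl
  exact hi₀ (Finset.mem_image_of_mem g (Finset.mem_univ s))

open scoped RealInnerProductSpace in
/-- Bárány's **colorful Carathéodory theorem**. -/
theorem colorful_caratheodory {E : Type*} [NormedAddCommGroup E]
    [InnerProductSpace ℝ E] [FiniteDimensional ℝ E] {ι κ : Type*} [Fintype ι] [Finite κ]
    (hcard : Module.finrank ℝ E + 1 ≤ Fintype.card ι) (C : ι → κ → E)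
    (hC : ∀ i, 0 ∈ convexHull ℝ (range (C i))) :
    ∃ c : ι → κ, 0 ∈ convexHull ℝ (range fun i => C i (c i)) := by
  classical
  have hι : Nonempty ι := Fintype.card_pos_iff.1 (by omega)
  have hκ : Nonempty κ := by
    obtain ⟨i⟩ := hι
    exact range_nonempty_iff_nonempty.1 (convexHull_nonempty_iff.1 ⟨0, hC i⟩)
  let K : (ι → κ) → Set E := fun c => convexHull ℝ (range fun i => C i (c i))
  have hK : ∀ c, (K c).Nonempty := fun c => (range_nonempty _).convexHull
  -- Take the rainbow hull nearest to `0`. If it misses `0`, one color is not needed for the nearest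
  -- point `z` and can be re-chosen on the other side, contradicting minimality.
  obtain ⟨c, hc⟩ := Finite.exists_min fun c => Metric.infDist 0 (K c)
  obtain ⟨z, hzK, hz⟩ := ((finite_range fun i => C i (c i)).isCompact_convexHull
    (𝕜 := ℝ)).exists_infDist_eq_dist (hK c) 0
  have hmin : ∀ c', ∀ w ∈ K c', ‖z‖ ≤ ‖w‖ := fun c' w hw => by
    have := (hc c').trans (Metric.infDist_le_dist_of_mem hw)
    rw [hz] at this
    simpa using this
  by_cases hz0 : z = 0
  · exact ⟨c, hz0 ▸ hzK⟩
  obtain ⟨i₀, hi₀⟩ := exists_mem_convexHull_image_ne hcard hz0 hzK fun i =>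
    norm_sq_le_inner_of_forall_norm_le (convex_convexHull ℝ _) hzK (hmin c)
      (subset_convexHull ℝ _ ⟨i, rfl⟩)
  obtain ⟨k, hk⟩ : ∃ k, ⟪z, C i₀ k⟫ ≤ 0 := by
    by_contra! h
    have hsub : convexHull ℝ (range (C i₀)) ⊆ {w | 0 < innerSL ℝ z w} :=
      convexHull_min (by rintro _ ⟨k, rfl⟩; exact h k)
        (convex_halfSpace_gt (innerSL ℝ z).toLinearMap.isLinear 0)
    have := hsub (hC i₀)
    simp at this
  have h := norm_sq_le_inner_of_forall_norm_le (convex_convexHull ℝ _)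
    (convexHull_mono (by
      rintro _ ⟨i, hi, rfl⟩
      exact ⟨i, by simp [Function.update_of_ne hi]⟩) hi₀) (hmin (Function.update c i₀ k))
    (subset_convexHull ℝ _ ⟨i₀, rfl⟩)
  simp only [Function.update_self] at h
  exact absurd (pow_eq_zero_iff two_ne_zero |>.1 (le_antisymm (h.trans hk) (sq_nonneg _)))
    (norm_ne_zero_iff.2 hz0)

/-- **Tverberg's theorem**: `(r - 1)(d + 1) + 1` points in `ℝᵈ` can be split into `r` parts whose
convex hulls have a common point. Here `r - 1` is the cardinality of `κ`. -/
theorem tverberg {ι κ δ : Type*} [Fintype ι] [Fintype κ] [Fintype δ]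
    (hcard : Fintype.card κ * (Fintype.card δ + 1) + 1 ≤ Fintype.card ι)
    (x : ι → EuclideanSpace ℝ δ) :
    ∃ (j : ι → Option κ) (p : EuclideanSpace ℝ δ), ∀ k, p ∈ convexHull ℝ (x '' {i | j i = k}) := by
  classical
  -- Sarkaria's trick: the `r` vectors `s o` in `ℝ^(r-1)` sum to zero, and this is their only linear
  -- relation up to scale. Tensoring with the lifts `y i = (1, x i)` gives dimension `(r - 1)(d +
  -- 1)`.
  let s : Option κ → κ → ℝ := fun o k => o.elim (-1) fun k' => if k' = k then 1 else 0
  let y : ι → Option δ → ℝ := fun i o => o.elim 1 (x i)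
  let v : ι → Option κ → EuclideanSpace ℝ (κ × Option δ) := fun i o =>
    WithLp.toLp 2 fun a => s o a.1 * y i a.2
  have hv : ∀ i, 0 ∈ convexHull ℝ (range (v i)) := by
    intro i
    have hsum : ∑ o, (Fintype.card (Option κ) : ℝ)⁻¹ • v i o = 0 := by
      rw [← Finset.smul_sum]
      convert smul_zero _
      ext a
      simp [v, s, Fintype.sum_option]
    rw [← hsum]
    refine (convex_convexHull ℝ _).sum_mem (fun _ _ => by positivity) ?_ fun o _ =>
      subset_convexHull ℝ _ ⟨o, rfl⟩
    rw [Finset.sum_const, Finset.card_univ, nsmul_eq_mul, mul_inv_cancel₀]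
    exact Nat.cast_ne_zero.2 Fintype.card_ne_zero
  obtain ⟨j, hj⟩ := colorful_caratheodory (by simpa using hcard) v hv
  rw [convexHull_range_eq_exists_affineCombination] at hj
  obtain ⟨t, w, hw0, hw1, hw⟩ := hj
  rw [Finset.affineCombination_eq_linear_combination _ _ _ hw1] at hw
  let S : Option κ → Option δ → ℝ := fun k o => ∑ i ∈ t with j i = k, w i * y i o
  -- Coordinate `(k, o)` of the vanishing combination is `S (some k) o - S none o`.
  have hS : ∀ k o, S k o = S none o := by
    rintro (_ | k) o
    · rfl
    have h0 := congrArg (fun u : EuclideanSpace ℝ (κ × Option δ) => u (k, o)) hw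
    simp only [WithLp.ofLp_sum, Finset.sum_apply, v, PiLp.smul_apply, smul_eq_mul,
      PiLp.zero_apply] at h0
    rw [← sub_eq_zero, ← h0]
    simp only [S, Finset.sum_filter, ← Finset.sum_sub_distrib]
    refine Finset.sum_congr rfl fun i _ => ?_
    rcases hji : j i with _ | k'
    · simp [s]
    · by_cases hk : k' = k <;> simp [s, hk]
  have hfib : ∀ k, ∑ i ∈ t with j i = k, w i = S none none := fun k => by
    rw [← hS k none]
    simp [S, y]
  have hpos : 0 < S none none := by
    have h := Finset.sum_fiberwise t j w
    simp only [hfib, hw1, Finset.sum_const, nsmul_eq_mul] at h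
    exact pos_of_mul_pos_right (h ▸ one_pos) (Nat.cast_nonneg _)
  refine ⟨j, (S none none)⁻¹ • WithLp.toLp 2 fun c => S none (some c), fun k => ?_⟩
  have hmem := Finset.centerMass_mem_convexHull (R := ℝ) (s := x '' {i | j i = k})
    (t.filter fun i => j i = k) (w := w) (z := x) (fun i hi => hw0 i (Finset.mem_filter.1 hi).1)
    (by rwa [hfib]) (fun i hi => ⟨i, (Finset.mem_filter.1 hi).2, rfl⟩)
  convert hmem using 1
  rw [Finset.centerMass, hfib]
  congr 1
  ext c
  simp [← hS k (some c), S, y]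

/-- **Carathéodory's theorem** for an indexed family of points. -/
theorem exists_finset_card_le_mem_convexHull_image {ι E : Type*} [AddCommGroup E] [Module ℝ E]
    [FiniteDimensional ℝ E] {x : ι → E} {A : Set ι} {p : E} (hp : p ∈ convexHull ℝ (x '' A)) :
    ∃ B : Finset ι, ↑B ⊆ A ∧ B.card ≤ Module.finrank ℝ E + 1 ∧ p ∈ convexHull ℝ (x '' B) := by
  classical
  obtain ⟨τ, _, q, w, hq, hind, hw, hw1, hwp⟩ := eq_pos_convex_span_of_mem_convexHull hp
  choose g hgA hg using fun s : τ => hq (mem_range_self s)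
  refine ⟨Finset.univ.image g, by simpa [Set.subset_def] using hgA, ?_, ?_⟩
  · have := hind.card_le_finrank_succ
    have := Submodule.finrank_le (vectorSpan ℝ (range q))
    have := Finset.card_image_le (s := Finset.univ) (f := g)
    rw [Finset.card_univ] at this
    omega
  · rw [← hwp]
    exact (convex_convexHull ℝ _).sum_mem (fun s _ => (hw s).le) hw1 fun s _ =>
      subset_convexHull ℝ _ ⟨g s, by simp, hg s⟩

/-! ### Vertices and faces of polytopes -/

theorem IsPolytope.isCompact {N : ℕ} {P : Set (EuclideanSpace ℝ (Fin N))} (hP : IsPolytope P) :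
    IsCompact P := by
  obtain ⟨V, hV, rfl⟩ := hP
  exact hV.isCompact_convexHull ℝ

theorem IsPolytope.convex {N : ℕ} {P : Set (EuclideanSpace ℝ (Fin N))} (hP : IsPolytope P) :
    Convex ℝ P := by
  obtain ⟨V, -, rfl⟩ := hP
  exact convex_convexHull ℝ V

theorem IsPolytope.finite_extremePoints {N : ℕ} {P : Set (EuclideanSpace ℝ (Fin N))}
    (hP : IsPolytope P) : (P.extremePoints ℝ).Finite := by
  obtain ⟨V, hV, rfl⟩ := hP
  exact hV.subset extremePoints_convexHull_subset

theorem isPolytope_momentPolytope (m : ℕ) {n : ℕ} (t : Fin n → ℝ) :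
    IsPolytope (momentPolytope m t) :=
  ⟨_, finite_range _, rfl⟩

/-- A nonempty exposed face of a polytope contains a vertex of the polytope. -/
theorem IsPolytope.exists_mem_extremePoints {N : ℕ} {P F : Set (EuclideanSpace ℝ (Fin N))}
    (hP : IsPolytope P) (hF : IsExposed ℝ P F) (hne : F.Nonempty) :
    ∃ v ∈ P.extremePoints ℝ, v ∈ F := by
  obtain ⟨v, hv⟩ := (hF.isCompact hP.isCompact).extremePoints_nonempty hne
  exact ⟨v, hF.isExtreme.extremePoints_subset_extremePoints hv, extremePoints_subset hv⟩

/-- The vertices of a polytope are exposed. -/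
theorem IsPolytope.isExposed_singleton {N : ℕ} {P : Set (EuclideanSpace ℝ (Fin N))}
    (hP : IsPolytope P) {v : EuclideanSpace ℝ (Fin N)} (hv : v ∈ P.extremePoints ℝ) :
    IsExposed ℝ P {v} := by
  have hcpt := hP.isCompact
  obtain ⟨V, hV, rfl⟩ := hP
  have hconv := ((convex_convexHull ℝ V).mem_extremePoints_iff_convex_sdiff.1 hv).2
  have hnot : v ∉ convexHull ℝ (V \ {v}) := fun h =>
    (convexHull_min (sdiff_subset_sdiff_left (subset_convexHull ℝ V)) hconv h).2 rfl
  obtain ⟨l, u, hlu, huv⟩ := geometric_hahn_banach_closed_point (convex_convexHull ℝ _)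
    ((hV.subset sdiff_subset).isClosed_convexHull ℝ) hnot
  have hlt : ∀ y ∈ V, y ≠ v → l y < l v := fun y hy hyv =>
    (hlu y (subset_convexHull ℝ _ ⟨hy, hyv⟩)).trans huv
  have hle : convexHull ℝ V ⊆ {y | l y ≤ l v} :=
    convexHull_min (fun y hy => by
      by_cases h : y = v
      · exact h ▸ le_refl (l v)
      · exact (hlt y hy h).le) (convex_halfSpace_le l.toLinearMap.isLinear _)
  have hexp : IsExposed ℝ (convexHull ℝ V) (l.toExposed (convexHull ℝ V)) :=
    ContinuousLinearMap.toExposed.isExposed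
  have hvmem : v ∈ l.toExposed (convexHull ℝ V) := ⟨hv.1, fun y hy => hle hy⟩
  have hext : (l.toExposed (convexHull ℝ V)).extremePoints ℝ ⊆ {v} := by
    intro y hy
    by_contra hyv
    have hyV := extremePoints_convexHull_subset
      (hexp.isExtreme.extremePoints_subset_extremePoints hy)
    exact (hlt y hyV hyv).not_ge (hy.1.2 v hv.1)
  have hsub : l.toExposed (convexHull ℝ V) ⊆ {v} := by
    rw [← closure_convexHull_extremePoints (hexp.isCompact hcpt)
      (hexp.convex (convex_convexHull ℝ V))]
    exact closure_minimal (convexHull_min hext (convex_singleton v)) isClosed_singleton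
  rwa [hsub.antisymm (singleton_subset_iff.2 hvmem)] at hexp

instance {N : ℕ} (P : Set (EuclideanSpace ℝ (Fin N))) : OrderBot (Face P) where
  bot := ⟨∅, isExposed_empty⟩
  bot_le F := Subtype.coe_le_coe.1 (empty_subset F.1)

theorem Face.coe_bot {N : ℕ} (P : Set (EuclideanSpace ℝ (Fin N))) :
    ((⊥ : Face P) : Set (EuclideanSpace ℝ (Fin N))) = ∅ :=
  rfl

/-- The atoms of the face lattice of a polytope are its vertices. -/
theorem IsPolytope.isAtom_face_iff {N : ℕ} {P : Set (EuclideanSpace ℝ (Fin N))}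
    (hP : IsPolytope P) {F : Face P} :
    IsAtom F ↔ ∃ v ∈ P.extremePoints ℝ, (F : Set (EuclideanSpace ℝ (Fin N))) = {v} := by
  have hbot : ∀ G : Face P, G = ⊥ ↔ (G : Set (EuclideanSpace ℝ (Fin N))) = ∅ := fun G => by
    rw [← Face.coe_bot P, Subtype.ext_iff]
  constructor
  · intro h
    obtain ⟨v, hv, hvF⟩ := hP.exists_mem_extremePoints F.2
      (nonempty_iff_ne_empty.2 fun h0 => h.1 ((hbot F).2 h0))
    refine ⟨v, hv, ?_⟩
    rcases h.le_iff.1 (show (⟨{v}, hP.isExposed_singleton hv⟩ : Face P) ≤ F from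
      singleton_subset_iff.2 hvF) with h' | h'
    · exact absurd ((hbot _).1 h') (singleton_ne_empty v)
    · rw [← h']
  · rintro ⟨v, hv, hF⟩
    refine ⟨fun h => singleton_ne_empty v (hF ▸ (hbot F).1 h), fun G hG => (hbot G).2 ?_⟩
    have hG' : (G : Set (EuclideanSpace ℝ (Fin N))) ⊂ {v} := hF ▸ hG
    exact ssubset_singleton_iff.1 hG'

/-! ### Neighborliness of cyclic polytopes -/

/-- A polytope is weakly `k`-neighborly if any `k` of its vertices are the vertices of a face. -/
def IsNeighborly {N : ℕ} (k : ℕ) (P : Set (EuclideanSpace ℝ (Fin N))) : Prop :=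
  ∀ S : Finset (EuclideanSpace ℝ (Fin N)), ↑S ⊆ P.extremePoints ℝ → S.card ≤ k →
    ∃ F : Face P, ∀ v ∈ P.extremePoints ℝ, v ∈ (F : Set (EuclideanSpace ℝ (Fin N))) ↔ v ∈ S

/-- Vertices are the atoms of the face lattice and incidence is its order, so a lattice isomorphism
preserves neighborliness. -/
theorem IsNeighborly.of_combinatoriallyEquivalent {N M k : ℕ}
    {P : Set (EuclideanSpace ℝ (Fin N))} {Q : Set (EuclideanSpace ℝ (Fin M))}
    (hP : IsPolytope P) (hQ : IsPolytope Q) (h : CombinatoriallyEquivalent P Q)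
    (hk : IsNeighborly k Q) : IsNeighborly k P := by
  classical
  obtain ⟨e⟩ := h
  let pt : P.extremePoints ℝ → Face P := fun v => ⟨{v.1}, hP.isExposed_singleton v.2⟩
  have hpt : ∀ v F, pt v ≤ F ↔ v.1 ∈ (F : Set (EuclideanSpace ℝ (Fin N))) := fun v F =>
    singleton_subset_iff
  choose q hq heq using fun v => hQ.isAtom_face_iff.1
    ((e.isAtom_iff (pt v)).2 (hP.isAtom_face_iff.2 ⟨v, v.2, rfl⟩))
  have hqinj : Function.Injective q := fun v v' hvv => by
    have h := e.injective (Subtype.ext ((heq v).trans (hvv ▸ (heq v').symm)))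
    exact Subtype.ext (singleton_injective (congrArg Subtype.val h))
  have hmem : ∀ v G, q v ∈ (G : Face Q).1 ↔ v.1 ∈ (e.symm G).1 := fun v G => by
    rw [← hpt, ← e.le_iff_le, e.apply_symm_apply, ← singleton_subset_iff, ← heq]
    rfl
  intro S hS hcard
  let T := S.attach.image fun v : {v // v ∈ S} => q ⟨v, hS (Finset.mem_coe.2 v.2)⟩
  obtain ⟨G, hG⟩ := hk T (by
    intro y hy
    obtain ⟨v, -, rfl⟩ := Finset.mem_image.1 hy
    exact hq _) (Finset.card_image_le.trans (by simpa using hcard))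
  refine ⟨e.symm G, fun v hv => ?_⟩
  rw [← hmem ⟨v, hv⟩, hG _ (hq _)]
  constructor
  · intro h
    obtain ⟨v', -, h⟩ := Finset.mem_image.1 h
    have hvv : v'.1 = v := congrArg Subtype.val (hqinj h)
    exact hvv ▸ v'.2
  · exact fun h => Finset.mem_image.2 ⟨⟨v, h⟩, Finset.mem_attach _ _, rfl⟩

open Polynomial in
/-- Any `k ≤ m / 2` of the points spanning a moment polytope are cut out by a face. -/
theorem exists_face_momentPolytope {m n : ℕ} {t : Fin n → ℝ} (ht : Function.Injective t)
    {T : Finset (Fin n)} (hT : 2 * T.card ≤ m) :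
    ∃ F : Face (momentPolytope m t), ∀ j,
      momentCurve m (t j) ∈ (F : Set (EuclideanSpace ℝ (Fin m))) ↔ j ∈ T := by
  obtain rfl | ⟨j₀, hj₀⟩ := T.eq_empty_or_nonempty
  · exact ⟨⊥, fun j => ⟨fun h => absurd h (by simp [Face.coe_bot]), fun h => absurd h (by simp)⟩⟩
  -- `p` is nonnegative, of degree at most `m`, and vanishes among the parameters exactly on `T`.
  -- Its nonconstant part, negated, is a linear functional along the curve, maximal at those points.
  let p : ℝ[X] := ∏ i ∈ T, (X - C (t i)) ^ 2
  have hdeg : p.natDegree < m + 1 := by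
    have : p.natDegree ≤ ∑ i ∈ T, 2 := (natDegree_prod_le _ _).trans
      (Finset.sum_le_sum fun i _ => by simp [natDegree_pow])
    rw [Finset.sum_const, smul_eq_mul] at this
    omega
  have hpos : ∀ s, 0 ≤ p.eval s := fun s => by
    simp only [p, eval_prod]
    exact Finset.prod_nonneg fun i _ => by simp [sq_nonneg]
  have hzero : ∀ j, p.eval (t j) = 0 ↔ j ∈ T := fun j => by
    simp only [p, eval_prod, Finset.prod_eq_zero_iff]
    simp [sub_eq_zero, ht.eq_iff]
  let l : StrongDual ℝ (EuclideanSpace ℝ (Fin m)) :=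
    ∑ i : Fin m, -p.coeff (i + 1) • EuclideanSpace.proj i
  have hl : ∀ s, l (momentCurve m s) = p.coeff 0 - p.eval s := fun s => by
    rw [eval_eq_sum_range' hdeg, Finset.sum_range_succ', ← Fin.sum_univ_eq_sum_range
      (fun i => p.coeff (i + 1) * s ^ (i + 1))]
    simp [l, momentCurve]
  have hmem : ∀ j, momentCurve m (t j) ∈ momentPolytope m t := fun j =>
    subset_convexHull ℝ _ ⟨j, rfl⟩
  have hle : momentPolytope m t ⊆ {y | l y ≤ p.coeff 0} :=
    convexHull_min (by
      rintro _ ⟨j, rfl⟩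
      simpa [hl] using hpos (t j)) (convex_halfSpace_le l.toLinearMap.isLinear _)
  refine ⟨⟨l.toExposed _, ContinuousLinearMap.toExposed.isExposed⟩, fun j => ?_⟩
  rw [← hzero]
  constructor
  · intro h
    have := h.2 _ (hmem j₀)
    rw [hl, hl, (hzero j₀).2 hj₀] at this
    linarith [hpos (t j)]
  · intro h
    refine ⟨hmem j, fun y hy => ?_⟩
    rw [hl, h, sub_zero]
    exact hle hy

theorem isNeighborly_momentPolytope {m n k : ℕ} {t : Fin n → ℝ} (ht : Function.Injective t)
    (hk : 2 * k ≤ m) : IsNeighborly k (momentPolytope m t) := by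
  classical
  intro S hS hcard
  have hpar : ∀ v : (momentPolytope m t).extremePoints ℝ, ∃ j, momentCurve m (t j) = v :=
    fun v => mem_range.1 (extremePoints_convexHull_subset v.2)
  choose g hg using hpar
  let T := S.attach.image fun v : {v // v ∈ S} => g ⟨v, hS (Finset.mem_coe.2 v.2)⟩
  have hT : T.card ≤ S.card := Finset.card_image_le.trans (by simp)
  obtain ⟨F, hF⟩ := exists_face_momentPolytope (m := m) ht (T := T) (by omega)
  refine ⟨F, fun v hv => ?_⟩
  have hgv : momentCurve m (t (g ⟨v, hv⟩)) = v := hg ⟨v, hv⟩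
  have hFv := hF (g ⟨v, hv⟩)
  rw [hgv] at hFv
  rw [hFv]
  constructor
  · intro h
    obtain ⟨v', -, h⟩ := Finset.mem_image.1 h
    rw [← hgv, ← h, hg]
    exact v'.2
  · exact fun h => Finset.mem_image.2 ⟨⟨v, h⟩, Finset.mem_attach _ _, rfl⟩

theorem IsCyclicPolytope.isNeighborly {N k : ℕ} {P : Set (EuclideanSpace ℝ (Fin N))}
    (hP : IsCyclicPolytope P) (hk : 2 * k ≤ polytopeDim P) : IsNeighborly k P := by
  obtain ⟨hP, n, t, -, ht, he⟩ := hP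
  exact .of_combinatoriallyEquivalent hP (isPolytope_momentPolytope _ t) he
    (isNeighborly_momentPolytope ht.injective hk)

/-! ### Assembling the disjoint faces -/

theorem IsAffineOn.convex_image {N d : ℕ} {P F : Set (EuclideanSpace ℝ (Fin N))}
    {f : EuclideanSpace ℝ (Fin N) → EuclideanSpace ℝ (Fin d)} (hf : IsAffineOn P f)
    (hFP : F ⊆ P) (hF : Convex ℝ F) : Convex ℝ (f '' F) := by
  rintro _ ⟨x, hx, rfl⟩ _ ⟨y, hy, rfl⟩ a b ha hb hab
  exact ⟨_, hF hx hy ha hb hab, hf x (hFP hx) y (hFP hy) a b ha hb hab⟩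

theorem corollary4p2 (d r : ℕ) (hd : 1 ≤ d) (hr : 3 ≤ r) {N : ℕ}
    (P : Set (EuclideanSpace ℝ (Fin N))) (hP : IsCyclicPolytope P)
    (hdim : 2 * (d + 1) ≤ polytopeDim P)
    (hvert : (r - 1) * (d + 1) + 1 ≤ (P.extremePoints ℝ).ncard)
    (f : EuclideanSpace ℝ (Fin N) → EuclideanSpace ℝ (Fin d)) (hf : IsAffineOn P f) :
    ∃ F : Fin r → Face P,
      (∀ i j, i ≠ j → Disjoint (F i : Set (EuclideanSpace ℝ (Fin N))) (F j)) ∧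
      (⋂ i, f '' (F i : Set (EuclideanSpace ℝ (Fin N)))).Nonempty := by
  classical
  have hnb := hP.isNeighborly hdim
  have hP' := hP.1
  have := hP'.finite_extremePoints.fintype
  let φ : Fin r ≃ Option (Fin (r - 1)) := Fintype.equivOfCardEq (by
    rw [Fintype.card_option, Fintype.card_fin, Fintype.card_fin]
    omega)
  obtain ⟨j, p, hp⟩ := tverberg (κ := Fin (r - 1)) (ι := P.extremePoints ℝ) (by
    rw [← Nat.card_eq_fintype_card (α := P.extremePoints ℝ), Nat.card_coe_set_eq]
    simpa using hvert) fun v => f v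
  choose B hBj hBcard hB using fun i => exists_finset_card_le_mem_convexHull_image (hp (φ i))
  rw [finrank_euclideanSpace_fin] at hBcard
  choose F hF using fun i => hnb ((B i).map (Function.Embedding.subtype _))
    (fun v hv => by
      obtain ⟨w, -, rfl⟩ := Finset.mem_map.1 hv
      exact w.2) (by simpa using hBcard i)
  have hmem : ∀ i (v : P.extremePoints ℝ), v.1 ∈ (F i).1 ↔ v ∈ B i := fun i v => by
    simp [hF i v v.2]
  refine ⟨F, fun i i' hii => disjoint_iff_inter_eq_empty.2 ?_, p, mem_iInter.2 fun i => ?_⟩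
  -- The intersection is again an exposed face. If nonempty it contains a vertex, which would lie in
  -- two Tverberg classes.
  · by_contra hne
    obtain ⟨v, hv, hvi, hvi'⟩ := hP'.exists_mem_extremePoints ((F i).2.inter (F i').2)
      (nonempty_iff_ne_empty.2 hne)
    have h := hBj i ((hmem i ⟨v, hv⟩).1 hvi)
    have h' := hBj i' ((hmem i' ⟨v, hv⟩).1 hvi')
    exact hii (φ.injective (h.symm.trans h'))
  · refine convexHull_min ?_ (hf.convex_image (F i).2.subset ((F i).2.convex hP'.convex)) (hB i)
    rintro _ ⟨v, hv, rfl⟩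
    exact ⟨v, (hmem i v).2 hv, rfl⟩
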